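/- For integers $n\ge 0$ put $(a;q)_n:=\prod_{i=0}^{n-1}(1-aq^i)$ and $(q)_n:=(q;q)_n$, and for integers $n_1,n_2,m\ge 0$ let \[K(n_1,n_2,m):=6(n_1+n_2)^2+2m^2+6m(n_1+n_2)-n_1+n_2-m.\] Then for all complex numbers $x$ and $q$ with $|q|<1$, \begin{align*} \sum_{n_1,n_2,m\ge 0}&\frac{x^{2n_1+2n_2+m}\,q^{K(n_1,n_2,m)+2m}}{(q^6;q^6)_{n_1}(q^6;q^6)_{n_2}(q)_m}\left(1+xq^{6n_1+6n_2+3m+1}+xq^{6n_1+6n_2+3m+2}+x^2q^{12n_1+12n_2+6m+6}\right)\\ &=\sum_{n_1,n_2,m\ge 0}\frac{x^{2n_1+2n_2+m}\,q^{K(n_1,n_2,m)}}{(q^6;q^6)_{n_1}(q^6;q^6)_{n_2}(q)_m}, \end{align*} where both triple series converge absolutely. -/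

import Mathlib

/-- The `q`-Pochhammer symbol `(a; q)_n = (1 - a) (1 - a q) ⋯ (1 - a q^(n-1))`. -/
def qPochhammer (a q : ℂ) (n : ℕ) : ℂ :=
  ∏ i ∈ Finset.range n, (1 - a * q ^ i)

/-- The quadratic exponent
`K(n₁, n₂, m) = 6 (n₁ + n₂)² + 2 m² + 6 m (n₁ + n₂) - n₁ + n₂ - m`, an integer. -/
def weightK (n₁ n₂ m : ℕ) : ℤ :=
  6 * ((n₁ : ℤ) + n₂) ^ 2 + 2 * (m : ℤ) ^ 2 + 6 * (m : ℤ) * ((n₁ : ℤ) + n₂)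
    - (n₁ : ℤ) + (n₂ : ℤ) - (m : ℤ)

/-- The `(n₁, n₂, m)` term of the series after the even-odd split. -/
noncomputable def splitTerm (x q : ℂ) (n₁ n₂ m : ℕ) : ℂ :=
  x ^ (2 * n₁ + 2 * n₂ + m) * q ^ (weightK n₁ n₂ m + 2 * (m : ℤ)) /
      (qPochhammer (q ^ 6) (q ^ 6) n₁ * qPochhammer (q ^ 6) (q ^ 6) n₂ * qPochhammer q q m) *
    (1 + x * q ^ (6 * n₁ + 6 * n₂ + 3 * m + 1) + x * q ^ (6 * n₁ + 6 * n₂ + 3 * m + 2)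
      + x ^ 2 * q ^ (12 * n₁ + 12 * n₂ + 6 * m + 6))

/-- The `(n₁, n₂, m)` term of Kurşungöz's series. -/
noncomputable def kursungozTerm (x q : ℂ) (n₁ n₂ m : ℕ) : ℂ :=
  x ^ (2 * n₁ + 2 * n₂ + m) * q ^ weightK n₁ n₂ m /
    (qPochhammer (q ^ 6) (q ^ 6) n₁ * qPochhammer (q ^ 6) (q ^ 6) n₂ * qPochhammer q q m)

/-! Let S_c(x) be the triple series with an extra factor q^(cm). Multiplying a term by 1 - q^m
cancels the last factor of (q)_m; shifting m then gives S_c(x) = S_{c+1}(x) + x q^(c+1) S_{c+1}(x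
q^3) (`tsum_shiftedTerm`). Two applications starting from S_0 produce the four-term factor. Natural
exponents let q = 0 be treated uniformly. -/

/-- `weightK` with the linear term in `m` raised by `c`, as a natural number. -/
def natWeight (c n₁ n₂ m : ℕ) : ℕ :=
  (weightK n₁ n₂ m + c * m).toNat

theorem sq_add_sq_add_sq_le_weightK (n₁ n₂ m : ℕ) :
    (n₁ : ℤ) ^ 2 + (n₂ : ℤ) ^ 2 + (m : ℤ) ^ 2 ≤ weightK n₁ n₂ m := by
  have self_le_sq : ∀ k : ℕ, (k : ℤ) ≤ (k : ℤ) ^ 2 := fun k => by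
    exact_mod_cast Nat.le_self_pow two_ne_zero k
  have h₁ := self_le_sq n₁
  have h₂ := self_le_sq m
  have h₃ : (0 : ℤ) ≤ n₁ * n₂ := by positivity
  have h₄ : (0 : ℤ) ≤ m * (n₁ + n₂) := by positivity
  have h₅ : (0 : ℤ) ≤ n₂ := by positivity
  unfold weightK
  nlinarith [sq_nonneg (n₁ : ℤ), sq_nonneg (n₂ : ℤ)]

theorem natCast_natWeight (c n₁ n₂ m : ℕ) :
    (natWeight c n₁ n₂ m : ℤ) = weightK n₁ n₂ m + c * m := by
  refine Int.toNat_of_nonneg ?_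
  have := sq_add_sq_add_sq_le_weightK n₁ n₂ m
  have : (0 : ℤ) ≤ c * m := by positivity
  nlinarith [sq_nonneg (n₁ : ℤ), sq_nonneg (n₂ : ℤ), sq_nonneg (m : ℤ)]

theorem natWeight_succ_left (c n₁ n₂ m : ℕ) :
    natWeight (c + 1) n₁ n₂ m = natWeight c n₁ n₂ m + m := by
  zify
  simp only [natCast_natWeight]
  push_cast
  ring

/-- The last summand is three times the exponent of `x`, so it is absorbed by `x ↦ x * q ^ 3`. -/
theorem natWeight_succ_right (c n₁ n₂ m : ℕ) :
    natWeight c n₁ n₂ (m + 1) =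
      c + 1 + natWeight (c + 1) n₁ n₂ m + 3 * (2 * n₁ + 2 * n₂ + m) := by
  zify
  simp only [natCast_natWeight, weightK]
  push_cast
  ring

theorem sq_add_sq_add_sq_le_natWeight (c n₁ n₂ m : ℕ) :
    n₁ ^ 2 + n₂ ^ 2 + m ^ 2 ≤ natWeight c n₁ n₂ m := by
  zify
  rw [natCast_natWeight]
  have := sq_add_sq_add_sq_le_weightK n₁ n₂ m
  have : (0 : ℤ) ≤ c * m := by positivity
  linarith

theorem qPochhammer_succ (a q : ℂ) (n : ℕ) :
    qPochhammer a q (n + 1) = qPochhammer a q n * (1 - a * q ^ n) :=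
  Finset.prod_range_succ _ _

theorem one_sub_norm_pow_le_norm_qPochhammer {a q : ℂ} (hq : ‖q‖ ≤ 1) (ha : ‖a‖ ≤ 1) (n : ℕ) :
    (1 - ‖a‖) ^ n ≤ ‖qPochhammer a q n‖ := by
  induction n with
  | zero => simp [qPochhammer]
  | succ n ih =>
    rw [qPochhammer_succ, norm_mul, pow_succ]
    refine mul_le_mul ih ?_ (sub_nonneg.2 ha) (norm_nonneg _)
    have h₁ : ‖a * q ^ n‖ ≤ ‖a‖ := by
      rw [norm_mul, norm_pow]
      exact mul_le_of_le_one_right (norm_nonneg _) (pow_le_one₀ (norm_nonneg _) hq)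
    have h₂ := norm_sub_norm_le (1 : ℂ) (a * q ^ n)
    rw [norm_one] at h₂
    linarith

theorem qPochhammer_ne_zero {a q : ℂ} (hq : ‖q‖ ≤ 1) (ha : ‖a‖ < 1) (n : ℕ) :
    qPochhammer a q n ≠ 0 := by
  have h := one_sub_norm_pow_le_norm_qPochhammer hq ha.le n
  have : 0 < (1 - ‖a‖) ^ n := pow_pos (sub_pos.2 ha) n
  exact norm_pos_iff.1 (this.trans_le h)

theorem norm_inv_qPochhammer_le {a q : ℂ} (hq : ‖q‖ ≤ 1) (ha : ‖a‖ < 1) (n : ℕ) :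
    ‖(qPochhammer a q n)⁻¹‖ ≤ ((1 - ‖a‖)⁻¹) ^ n := by
  rw [norm_inv, inv_pow]
  exact inv_anti₀ (pow_pos (sub_pos.2 ha) n) (one_sub_norm_pow_le_norm_qPochhammer hq ha.le n)

theorem summable_pow_mul_pow_sq (B : ℝ) {r : ℝ} (hr₀ : 0 ≤ r) (hr : r < 1) :
    Summable fun n : ℕ => B ^ n * r ^ n ^ 2 := by
  -- Ratio of consecutive terms, in absolute value.
  have hlim : Filter.Tendsto (fun n : ℕ => |B| * r ^ (2 * n + 1)) Filter.atTop (nhds 0) := by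
    have h : Filter.Tendsto (fun n : ℕ => 2 * n + 1) Filter.atTop Filter.atTop :=
      Filter.tendsto_atTop_mono (fun n => show n ≤ 2 * n + 1 by omega) Filter.tendsto_id
    simpa using ((tendsto_pow_atTop_nhds_zero_of_lt_one hr₀ hr).comp h).const_mul |B|
  refine summable_of_ratio_norm_eventually_le (r := 1 / 2) (by norm_num) ?_
  filter_upwards [hlim.eventually_le_const (show (0 : ℝ) < 1 / 2 by norm_num)] with n hn
  have h : B ^ (n + 1) * r ^ (n + 1) ^ 2 = B * r ^ (2 * n + 1) * (B ^ n * r ^ n ^ 2) := by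
    rw [show (n + 1) ^ 2 = 2 * n + 1 + n ^ 2 by ring]
    ring
  rw [h, norm_mul]
  refine mul_le_mul_of_nonneg_right ?_ (norm_nonneg _)
  rwa [norm_mul, Real.norm_eq_abs, Real.norm_of_nonneg (pow_nonneg hr₀ _)]

/-- Kurşungöz's term with an additional factor `q ^ (c * m)`. -/
noncomputable def shiftedTerm (c : ℕ) (x q : ℂ) (n : ℕ × ℕ × ℕ) : ℂ :=
  x ^ (2 * n.1 + 2 * n.2.1 + n.2.2) * q ^ natWeight c n.1 n.2.1 n.2.2 /
    (qPochhammer (q ^ 6) (q ^ 6) n.1 * qPochhammer (q ^ 6) (q ^ 6) n.2.1 * qPochhammer q q n.2.2)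

/-- Quadratic decay in each index beats the geometric growth of the powers of `x` and of the inverse
Pochhammer symbols, so a product of three convergent series dominates. -/
theorem summable_shiftedTerm (c : ℕ) (x : ℂ) {q : ℂ} (hq : ‖q‖ < 1) :
    Summable (shiftedTerm c x q) := by
  have hq6 : ‖q ^ 6‖ < 1 := by
    rw [norm_pow]
    exact pow_lt_one₀ (norm_nonneg _) hq (by norm_num)
  have hD : 0 ≤ (1 - ‖q‖)⁻¹ := inv_nonneg.2 (sub_nonneg.2 hq.le)
  have hE : 0 ≤ (1 - ‖q ^ 6‖)⁻¹ := inv_nonneg.2 (sub_nonneg.2 hq6.le)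
  set D := (1 - ‖q‖)⁻¹
  set E := (1 - ‖q ^ 6‖)⁻¹
  have hs := summable_pow_mul_pow_sq (‖x‖ ^ 2 * E) (norm_nonneg q) hq
  have ht := summable_pow_mul_pow_sq (‖x‖ * D) (norm_nonneg q) hq
  have hst := hs.mul_of_nonneg (hs.mul_of_nonneg ht (fun n => by positivity)
    (fun n => by positivity)) (fun n => by positivity) (fun n => by positivity)
  refine Summable.of_norm_bounded hst ?_
  rintro ⟨n₁, n₂, m⟩
  have h₁ := norm_inv_qPochhammer_le hq6.le hq6 n₁
  have h₂ := norm_inv_qPochhammer_le hq6.le hq6 n₂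
  have h₃ := norm_inv_qPochhammer_le hq.le hq m
  have h₄ := pow_le_pow_of_le_one (norm_nonneg q) hq.le
    (sq_add_sq_add_sq_le_natWeight c n₁ n₂ m)
  calc ‖shiftedTerm c x q (n₁, n₂, m)‖
      = ‖x‖ ^ (2 * n₁ + 2 * n₂ + m) * ‖q‖ ^ natWeight c n₁ n₂ m *
        (‖(qPochhammer (q ^ 6) (q ^ 6) n₁)⁻¹‖ * ‖(qPochhammer (q ^ 6) (q ^ 6) n₂)⁻¹‖ *
          ‖(qPochhammer q q m)⁻¹‖) := by
        simp only [shiftedTerm, div_eq_mul_inv, mul_inv, norm_mul, norm_pow]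
    _ ≤ ‖x‖ ^ (2 * n₁ + 2 * n₂ + m) * ‖q‖ ^ (n₁ ^ 2 + n₂ ^ 2 + m ^ 2) *
        (E ^ n₁ * E ^ n₂ * D ^ m) := by gcongr
    _ = _ := by
        simp only [mul_pow, pow_add, ← pow_mul]
        ring

theorem shiftedTerm_mul_pow (c j : ℕ) (x q : ℂ) (n : ℕ × ℕ × ℕ) :
    shiftedTerm c (x * q ^ j) q n =
      q ^ (j * (2 * n.1 + 2 * n.2.1 + n.2.2)) * shiftedTerm c x q n := by
  simp only [shiftedTerm, mul_pow, ← pow_mul]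
  ring

theorem shiftedTerm_zero_sub (c : ℕ) (x q : ℂ) (n₁ n₂ : ℕ) :
    shiftedTerm c x q (n₁, n₂, 0) - shiftedTerm (c + 1) x q (n₁, n₂, 0) = 0 := by
  simp [shiftedTerm, natWeight_succ_left]

theorem shiftedTerm_succ_sub (c : ℕ) (x : ℂ) {q : ℂ} (hq : ‖q‖ < 1) (n₁ n₂ m : ℕ) :
    shiftedTerm c x q (n₁, n₂, m + 1) - shiftedTerm (c + 1) x q (n₁, n₂, m + 1) =
      x * q ^ (c + 1) * shiftedTerm (c + 1) (x * q ^ 3) q (n₁, n₂, m) := by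
  have hm : 1 - q * q ^ m ≠ 0 := by
    have := qPochhammer_ne_zero hq.le hq (m + 1)
    rw [qPochhammer_succ] at this
    exact right_ne_zero_of_mul this
  rw [shiftedTerm_mul_pow]
  simp only [shiftedTerm, natWeight_succ_left c n₁ n₂ (m + 1), natWeight_succ_right,
    qPochhammer_succ q]
  have h₁ := qPochhammer_ne_zero hq.le hq m
  have hq6 : ‖q ^ 6‖ < 1 := by
    rw [norm_pow]
    exact pow_lt_one₀ (norm_nonneg _) hq (by norm_num)
  have h₂ := qPochhammer_ne_zero hq6.le hq6 n₁
  have h₃ := qPochhammer_ne_zero hq6.le hq6 n₂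
  field_simp
  ring

theorem tsum_shiftedTerm (c : ℕ) (x : ℂ) {q : ℂ} (hq : ‖q‖ < 1) :
    ∑' n, shiftedTerm c x q n = ∑' n, shiftedTerm (c + 1) x q n +
      x * q ^ (c + 1) * ∑' n, shiftedTerm (c + 1) (x * q ^ 3) q n := by
  rw [← sub_eq_iff_eq_add', ← (summable_shiftedTerm c x hq).tsum_sub
    (summable_shiftedTerm (c + 1) x hq), ← tsum_mul_left]
  have hinj : Function.Injective fun n : ℕ × ℕ × ℕ => (n.1, n.2.1, n.2.2 + 1) := by
    rintro ⟨a, b, d⟩ ⟨a', b', d'⟩ h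
    simpa using h
  -- The difference vanishes at `m = 0`, so it is supported on the range of the shift.
  rw [← hinj.tsum_eq]
  · exact tsum_congr fun n => shiftedTerm_succ_sub c x hq n.1 n.2.1 n.2.2
  · rintro ⟨n₁, n₂, m⟩ hn
    cases m with
    | zero => exact absurd (shiftedTerm_zero_sub c x q n₁ n₂) hn
    | succ m => exact ⟨(n₁, n₂, m), rfl⟩

theorem kursungozTerm_eq_shiftedTerm (x q : ℂ) (n : ℕ × ℕ × ℕ) :
    kursungozTerm x q n.1 n.2.1 n.2.2 = shiftedTerm 0 x q n := by
  have h := natCast_natWeight 0 n.1 n.2.1 n.2.2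
  rw [Nat.cast_zero, zero_mul, add_zero] at h
  rw [kursungozTerm, shiftedTerm, ← h, zpow_natCast]

theorem splitTerm_eq_shiftedTerm (x q : ℂ) (n : ℕ × ℕ × ℕ) :
    splitTerm x q n.1 n.2.1 n.2.2 = shiftedTerm 2 x q n +
      (x * q + x * q ^ 2) * shiftedTerm 2 (x * q ^ 3) q n +
        x ^ 2 * q ^ 6 * shiftedTerm 2 (x * q ^ 6) q n := by
  rw [shiftedTerm_mul_pow, shiftedTerm_mul_pow, splitTerm, shiftedTerm,
    ← Nat.cast_two (R := ℤ), ← natCast_natWeight, zpow_natCast]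
  ring

theorem theorem5 (x q : ℂ) (hq : ‖q‖ < 1) :
    Summable (fun n : ℕ × ℕ × ℕ => splitTerm x q n.1 n.2.1 n.2.2) ∧
    Summable (fun n : ℕ × ℕ × ℕ => kursungozTerm x q n.1 n.2.1 n.2.2) ∧
    ∑' n : ℕ × ℕ × ℕ, splitTerm x q n.1 n.2.1 n.2.2 =
      ∑' n : ℕ × ℕ × ℕ, kursungozTerm x q n.1 n.2.1 n.2.2 := by
  simp only [splitTerm_eq_shiftedTerm, kursungozTerm_eq_shiftedTerm]
  have h₀ := summable_shiftedTerm 2 x hq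
  have h₃ := (summable_shiftedTerm 2 (x * q ^ 3) hq).mul_left (x * q + x * q ^ 2)
  have h₆ := (summable_shiftedTerm 2 (x * q ^ 6) hq).mul_left (x ^ 2 * q ^ 6)
  refine ⟨(h₀.add h₃).add h₆, summable_shiftedTerm 0 x hq, ?_⟩
  -- The recurrence at `c = 0`, then at `c = 1` for both `x` and `x * q ^ 3`.
  rw [(h₀.add h₃).tsum_add h₆, h₀.tsum_add h₃, tsum_mul_left, tsum_mul_left,
    tsum_shiftedTerm 0 x hq, tsum_shiftedTerm 1 x hq, tsum_shiftedTerm 1 (x * q ^ 3) hq,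
    mul_assoc x (q ^ 3) (q ^ 3), ← pow_add]
  ring
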